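/- Let $m\ge 1$ be an integer and let $G$ be a finite group. Put $V=\bigcup_{i=1}^m G_i$, where $G_i=\{x_i : x\in G\}$ are $m$ disjoint copies of $G$. For subsets $S_{i,j}\subseteq G$ ($1\le i,j\le m$) with $1\notin S_{i,i}$ for all $i$, the $m$-Cayley digraph $\mathrm{Cay}(G,S_{i,j}:1\le i,j\le m)$ has vertex set $V$ and arc set $\bigcup_{i,j}\{(x_i,(sx)_j) : s\in S_{i,j},\ x\in G\}$; it is called an $m$-Cayley graph if its arc set is symmetric. For $g\in G$ let $R(g)$ be the permutation $x_i\mapsto (xg)_i$ of $V$, let $R(G)=\{R(g):g\in G\}$, and let $N$ be the normalizer of $R(G)$ in the symmetric group on $V$. For a digraph $\Gamma$ on $V$ and $n\in N$ let $\Gamma^n$ be the digraph on $V$ with arc set $\{(u^n,v^n) : (u,v) \text{ an arc of } \Gamma\}$. An $m$-Cayley digraph (respectively graph) $\Gamma$ of $G$ is called $m$CI if for every $m$-Cayley digraph (respectively graph) $\Sigma$ of $G$ isomorphic to $\Gamma$ there is $n\in N$ with $\Gamma^n=\Sigma$. The group $G$ is an $m$DCI-group if every $m$-Cayley digraph of $G$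 is $m$CI, and an $m$CI-group if every $m$-Cayley graph of $G$ is $m$CI. Theorem. Let $m\ge 2$ be an integer and let $G$ be a finite group. Then (1) $G$ is an $m$CI-group if and only if either $m=2$ and $G$ is trivial or isomorphic to $\mathbb{Z}_3$, or $m\ge 3$ and $G$ is trivial; (2) $G$ is an $m$DCI-group if and only if $G$ is trivial. -/

import Mathlib

namespace MCayley

/-- The vertex set `V = G_1 ∪ ⋯ ∪ G_m`; the pair `(i, x)` is the vertex `x_i`. -/
abbrev Vertex (m : ℕ) (G : Type*) : Type _ := Fin m × G

section Digraphs

variable {V : Type*}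

/-- Two digraphs on `V` are isomorphic. -/
def Isomorphic (Γ Δ : Digraph V) : Prop := Nonempty (Γ.Adj ≃r Δ.Adj)

/-- The image `Γ^n` of a digraph under a permutation `n` of its vertices: its arcs are the pairs
`(n u, n v)` with `(u, v)` an arc of `Γ`. -/
def image (Γ : Digraph V) (n : Equiv.Perm V) : Digraph V where
  Adj a b := ∃ u v, Γ.Adj u v ∧ n u = a ∧ n v = b

/-- A digraph is a graph if its arc set is symmetric. -/
def IsGraph (Γ : Digraph V) : Prop := ∀ u v, Γ.Adj u v → Γ.Adj v u

end Digraphs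

section Groups

variable {m : ℕ} {G : Type*} [Group G]

/-- `Cay(G, S_{i,j} : 1 ≤ i, j ≤ m)`: the arcs are the pairs `(x_i, (s x)_j)` with `x ∈ G` and
`s ∈ S_{i,j}`. -/
def cay (S : Fin m → Fin m → Set G) : Digraph (Vertex m G) where
  Adj u v := ∃ i j : Fin m, ∃ x : G, ∃ s ∈ S i j, u = (i, x) ∧ v = (j, s * x)

/-- The `m`-Cayley digraphs of `G`. Digraphs have no loops, hence `1 ∉ S_{i,i}`. -/
def IsMCayleyDigraph (Γ : Digraph (Vertex m G)) : Prop :=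
  ∃ S : Fin m → Fin m → Set G, (∀ i, (1 : G) ∉ S i i) ∧ Γ = cay S

/-- The `m`-Cayley graphs of `G`. -/
def IsMCayleyGraph (Γ : Digraph (Vertex m G)) : Prop :=
  IsMCayleyDigraph Γ ∧ IsGraph Γ

variable (m) in
/-- The permutation `R(g) : x_i ↦ (x g)_i`. -/
def rightMul (g : G) : Equiv.Perm (Vertex m G) where
  toFun u := (u.1, u.2 * g)
  invFun u := (u.1, u.2 * g⁻¹)
  left_inv u := by simp
  right_inv u := by simp

variable (m G) in
/-- The semiregular permutation group `R(G) = {R(g) : g ∈ G}`. -/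
def rightRegular : Subgroup (Equiv.Perm (Vertex m G)) where
  carrier := Set.range (rightMul m)
  one_mem' := ⟨1, by ext u <;> simp [rightMul]⟩
  mul_mem' := by
    rintro _ _ ⟨g, rfl⟩ ⟨h, rfl⟩
    exact ⟨h * g, by ext u <;> simp [rightMul, mul_assoc]⟩
  inv_mem' := by
    rintro _ ⟨g, rfl⟩
    refine ⟨g⁻¹, ?_⟩
    rw [eq_inv_iff_mul_eq_one]
    ext u <;> simp [rightMul]

variable (m G) in
/-- The normalizer of `R(G)` in the symmetric group on the vertex set. -/
def normalizerR : Subgroup (Equiv.Perm (Vertex m G)) :=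
  Subgroup.normalizer (rightRegular m G : Set (Equiv.Perm (Vertex m G)))

/-- An `m`-Cayley digraph `Γ` is `m`CI if every `m`-Cayley digraph of `G` isomorphic to `Γ` is
`Γ^n` for some `n` in the normalizer of `R(G)`. -/
def IsMCIDigraph (Γ : Digraph (Vertex m G)) : Prop :=
  ∀ Δ : Digraph (Vertex m G), IsMCayleyDigraph Δ → Isomorphic Γ Δ →
    ∃ n ∈ normalizerR m G, image Γ n = Δ

/-- An `m`-Cayley graph `Γ` is `m`CI if every `m`-Cayley graph of `G` isomorphic to `Γ` is
`Γ^n` for some `n` in the normalizer of `R(G)`. -/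
def IsMCIGraph (Γ : Digraph (Vertex m G)) : Prop :=
  ∀ Δ : Digraph (Vertex m G), IsMCayleyGraph Δ → Isomorphic Γ Δ →
    ∃ n ∈ normalizerR m G, image Γ n = Δ

variable (m G) in
/-- `G` is an `m`DCI-group: every `m`-Cayley digraph of `G` is `m`CI. -/
def IsMDCIGroup : Prop :=
  ∀ Γ : Digraph (Vertex m G), IsMCayleyDigraph Γ → IsMCIDigraph Γ

variable (m G) in
/-- `G` is an `m`CI-group: every `m`-Cayley graph of `G` is `m`CI. -/
def IsMCIGroup : Prop :=
  ∀ Γ : Digraph (Vertex m G), IsMCayleyGraph Γ → IsMCIGraph Γ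

end Groups

end MCayley

/-! Normalizer elements permute the `R(G)`-orbits ("classes") and conjugate each `R(g)` to some
`R(s)` with one `s` for all classes. Isomorphic graphs that no such map can match obstruct the CI
property.

Two obstructions suffice for necessity. If `1 ≠ g` has order `k ≤ m`, then `|G|` copies of `K_k` fit
either inside classes or across them (`not_isMCIGroup_of_orderOf_le`). If `g`, `h` commute and have
equal order, with `g ≠ 1` and `h ≠ g`, `h ≠ g⁻¹`, then two joined classes can carry the cycles of
`g, g` or of `g, h` (`not_isMCIGroup_of_commute`). The pair `g, g²` excludes odd orders at least 5,
so only the prime 3 divides `|G|`, and `m = 2`. A central element of order 3 paired with an element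
outside its span then forces `|G| = 3`.

Conversely, for `ℤ₃` and `m = 2`, the degrees and the presence of triangles determine the diagonal
sets up to a swap and the size of `S 0 1`; equal-sized subsets of `ℤ₃` are translates. Directed
cycles with equal or opposite orientations defeat the digraph version. -/

namespace MCayley

/-! ### Adjacency, images and the normalizer of `R(G)` -/

section Basic

variable {m : ℕ} {G : Type*} [Group G]

theorem cay_adj (S : Fin m → Fin m → Set G) (u v : Vertex m G) :
    (cay S).Adj u v ↔ v.2 * u.2⁻¹ ∈ S u.1 v.1 := by
  constructor
  · rintro ⟨i, j, x, s, hs, rfl, rfl⟩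
    simpa using hs
  · intro h
    exact ⟨u.1, v.1, u.2, _, h, rfl, by simp⟩

theorem isMCayleyGraph_cay {S : Fin m → Fin m → Set G} (h1 : ∀ i, (1 : G) ∉ S i i)
    (hinv : ∀ i j s, s ∈ S i j → s⁻¹ ∈ S j i) : IsMCayleyGraph (cay S) := by
  refine ⟨⟨S, h1, rfl⟩, fun u v h => ?_⟩
  rw [cay_adj] at h ⊢
  simpa using hinv _ _ _ h

theorem image_eq_iff {V : Type*} (Γ Δ : Digraph V) (n : Equiv.Perm V) :
    image Γ n = Δ ↔ ∀ u v, Γ.Adj u v ↔ Δ.Adj (n u) (n v) := by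
  constructor
  · rintro rfl u v
    constructor
    · exact fun h => ⟨u, v, h, rfl, rfl⟩
    · rintro ⟨a, b, h, ha, hb⟩
      rwa [n.injective ha, n.injective hb] at h
  · intro h
    ext a b
    constructor
    · rintro ⟨u, v, huv, rfl, rfl⟩
      exact (h u v).1 huv
    · intro hab
      exact ⟨n.symm a, n.symm b, (h _ _).2 (by simpa using hab), by simp, by simp⟩

/-- An element of the normalizer of `R(G)` conjugates each `R(g)` to some `R(s)`. -/
theorem exists_apply_mul_of_mem_normalizerR {n : Equiv.Perm (Vertex m G)}
    (hn : n ∈ normalizerR m G) (g : G) :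
    ∃ s : G, ∀ i x, n (i, x * g) = ((n (i, x)).1, (n (i, x)).2 * s) := by
  obtain ⟨s, hs⟩ := (Subgroup.mem_normalizer_iff.1 hn (rightMul m g)).1 ⟨g, rfl⟩
  refine ⟨s, fun i x => ?_⟩
  have := congrArg (fun p : Equiv.Perm (Vertex m G) => p (n (i, x))) hs
  simpa [rightMul] using this.symm

/-- Some `R(g)` carries `n (i, x)` to `n (j, y)`; its conjugate by `n⁻¹` again preserves classes.
Thus `n` permutes the classes. -/
theorem eq_of_fst_apply_eq_of_mem_normalizerR {n : Equiv.Perm (Vertex m G)}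
    (hn : n ∈ normalizerR m G) {i j : Fin m} {x y : G} (h : (n (i, x)).1 = (n (j, y)).1) :
    i = j := by
  obtain ⟨s, hs⟩ := exists_apply_mul_of_mem_normalizerR (inv_mem hn)
    ((n (i, x)).2⁻¹ * (n (j, y)).2)
  have := congrArg Prod.fst (hs (n (i, x)).1 (n (i, x)).2)
  rw [mul_inv_cancel_left] at this
  nth_rw 1 [h] at this
  simpa using this.symm

theorem IsMCIGroup.exists_mem_normalizerR (hG : IsMCIGroup m G) {S T : Fin m → Fin m → Set G}
    (hS1 : ∀ i, (1 : G) ∉ S i i) (hS : ∀ i j s, s ∈ S i j → s⁻¹ ∈ S j i)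
    (hT1 : ∀ i, (1 : G) ∉ T i i) (hT : ∀ i j s, s ∈ T i j → s⁻¹ ∈ T j i)
    (φ : Equiv.Perm (Vertex m G))
    (hφ : ∀ u v, (cay S).Adj u v ↔ (cay T).Adj (φ u) (φ v)) :
    ∃ n ∈ normalizerR m G, ∀ u v, (cay S).Adj u v ↔ (cay T).Adj (n u) (n v) := by
  obtain ⟨n, hn, h⟩ := hG _ (isMCayleyGraph_cay hS1 hS) _ (isMCayleyGraph_cay hT1 hT)
    ⟨⟨φ, fun {a b} => (hφ a b).symm⟩⟩
  exact ⟨n, hn, (image_eq_iff _ _ _).1 h⟩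

theorem IsMDCIGroup.isMCIGroup (hG : IsMDCIGroup m G) : IsMCIGroup m G :=
  fun Γ hΓ Δ hΔ h => hG Γ hΓ.1 Δ hΔ.1 h

theorem isMDCIGroup_of_subsingleton [Subsingleton G] : IsMDCIGroup m G := by
  rintro Γ - Δ - ⟨φ⟩
  refine ⟨φ.toEquiv, ?_, (image_eq_iff _ _ _).2 fun u v => φ.map_rel_iff.symm⟩
  -- `R(G)` is trivial, so its normalizer is the whole symmetric group and any isomorphism serves.
  have hR : ∀ h : Equiv.Perm (Vertex m G), h ∈ rightRegular m G ↔ h = 1 := by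
    intro h
    constructor
    · rintro ⟨g, rfl⟩
      ext u
      · rfl
      · exact Subsingleton.elim _ _
    · rintro rfl
      exact one_mem _
  refine Subgroup.mem_normalizer_iff.2 fun h => ?_
  rw [hR, hR, conj_eq_one_iff]

end Basic

/-! ### Obstruction from elements of small order -/

section Order

variable {G : Type*} [Group G]

/-- Coordinates `x = g ^ a(x) * t(x)` with respect to the right cosets of `⟨g⟩`. -/
theorem exists_pow_mul_decomposition [Finite G] (g : G) :
    ∃ (a : G → ℕ) (t : G → G), (∀ x, a x < orderOf g) ∧ (∀ x, g ^ a x * t x = x) ∧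
      (∀ x y, t x = t y ↔ y * x⁻¹ ∈ Subgroup.zpowers g) ∧
      (∀ x i, t (g ^ i * t x) = t x) ∧ ∀ x i, i < orderOf g → a (g ^ i * t x) = i := by
  let r := QuotientGroup.rightRel (Subgroup.zpowers g)
  let t : G → G := fun x => (Quotient.mk r x).out
  have ht : ∀ x y, t x = t y ↔ y * x⁻¹ ∈ Subgroup.zpowers g := by
    intro x y
    rw [← QuotientGroup.rightRel_apply, Quotient.out_inj]
    exact Quotient.eq
  have htx : ∀ x, x * (t x)⁻¹ ∈ Subgroup.zpowers g := by
    intro x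
    rw [← QuotientGroup.rightRel_apply]
    exact Quotient.mk_out x
  have hex : ∀ x, ∃ n < orderOf g, g ^ n = x * (t x)⁻¹ := by
    intro x
    classical
    have := htx x
    rw [mem_zpowers_iff_mem_range_orderOf] at this
    simpa using this
  choose a ha hag using hex
  have hdec : ∀ x, g ^ a x * t x = x := fun x => by rw [hag]; group
  have htt : ∀ x i, t (g ^ i * t x) = t x := by
    intro x i
    have h1 : t (t x) = t x := (ht _ _).2 (htx x)
    have h2 : t (t x) = t (g ^ i * t x) :=
      (ht _ _).2 (by simp)
    rw [← h2, h1]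
  refine ⟨a, t, ha, hdec, ht, htt, fun x i hi => ?_⟩
  have := hdec (g ^ i * t x)
  rw [htt] at this
  exact pow_injOn_Iio_orderOf (ha _) hi (mul_right_cancel this)

/-- Connection sets of the graph `|G| K_k` whose components lie inside the orbits of `R(G)`. -/
def cliquesInside (m k : ℕ) (g : G) : Fin m → Fin m → Set G :=
  fun i j => {s | i = j ∧ (i : ℕ) < k ∧ s ≠ 1 ∧ s ∈ Subgroup.zpowers g}

/-- Connection sets of the graph `|G| K_k` whose components are transversal to the orbits. -/
def cliquesAcross (m k : ℕ) : Fin m → Fin m → Set G :=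
  fun i j => {s | i ≠ j ∧ (i : ℕ) < k ∧ (j : ℕ) < k ∧ s = 1}

theorem not_isMCIGroup_of_orderOf_le [Finite G] {m : ℕ} (g : G) (hg : g ≠ 1)
    (hgm : orderOf g ≤ m) : ¬ IsMCIGroup m G := by
  intro hG
  obtain ⟨a, t, ha, hdec, ht, htt, hat⟩ := exists_pow_mul_decomposition g
  set k := orderOf g
  -- Each coset of `⟨g⟩` gives a `k × k` grid, class index against exponent; transposing it
  -- exchanges cliques inside classes with cliques across them.
  let f : Vertex m G → Vertex m G := fun u =>
    if (u.1 : ℕ) < k then (⟨a u.2, (ha _).trans_le hgm⟩, g ^ (u.1 : ℕ) * t u.2) else u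
  have hf : Function.Involutive f := by
    rintro ⟨i, x⟩
    by_cases hi : (i : ℕ) < k
    · simp [f, hi, ha, hat, htt, hdec]
    · simp [f, hi]
  obtain ⟨n, hn, hadj⟩ := hG.exists_mem_normalizerR (S := cliquesInside m k g)
    (T := cliquesAcross m k) (by simp [cliquesInside])
    (by
      rintro i j s ⟨rfl, h1, h2, h3⟩
      exact ⟨rfl, h1, inv_ne_one.2 h2, inv_mem h3⟩)
    (by simp [cliquesAcross])
    (by
      rintro i j s ⟨h1, h2, h3, rfl⟩
      exact ⟨h1.symm, h3, h2, inv_one⟩)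
    hf.toPerm
    (by
      rintro ⟨i, x⟩ ⟨j, y⟩
      rw [cay_adj, cay_adj]
      by_cases hi : (i : ℕ) < k <;> by_cases hj : (j : ℕ) < k
      · simp only [cliquesInside, cliquesAcross, Function.Involutive.coe_toPerm, f, hi, hj, ha,
          if_true, Set.mem_ofPred_eq, true_and, ne_eq, mul_inv_eq_one, Fin.mk.injEq, ← ht]
        constructor
        · rintro ⟨rfl, hyx, htxy⟩
          refine ⟨fun h => hyx ?_, by rw [htxy]⟩
          rw [← hdec x, ← hdec y, h, htxy]
        · rintro ⟨h1, h2⟩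
          have e1 := congrArg a h2
          have e2 := congrArg t h2
          rw [hat _ _ hi, hat _ _ hj] at e1
          rw [htt, htt] at e2
          refine ⟨Fin.ext e1.symm, ?_, e2.symm⟩
          rintro rfl
          exact h1 rfl
      · have : i ≠ j := by rintro rfl; exact hj hi
        simp [cliquesInside, cliquesAcross, f, hi, hj, this]
      · simp [cliquesInside, cliquesAcross, f, hi, hj]
      · simp [cliquesInside, cliquesAcross, f, hi, hj])
  have hk0 : 0 < k := orderOf_pos g
  obtain ⟨s, hs⟩ := exists_apply_mul_of_mem_normalizerR hn g
  -- An edge inside a class would have to map to an edge inside a class, and the target has none.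
  have h := (hadj (⟨0, hk0.trans_le hgm⟩, 1) (⟨0, hk0.trans_le hgm⟩, 1 * g)).1
    ((cay_adj _ _ _).2 (by simp [cliquesInside, hg, hk0]))
  rw [cay_adj, hs] at h
  exact h.1 rfl

end Order

/-! ### Obstruction from commuting elements of equal order -/

section Commuting

variable {G : Type*} [Group G]

/-- Both left multiplications split `G` into equally many cycles of the same length; matching
transversals conjugates one to the other. -/
theorem exists_perm_mul_of_orderOf_eq [Finite G] {g h : G} (hgh : orderOf g = orderOf h) :
    ∃ f : Equiv.Perm G, ∀ x, f (g * x) = h * f x := by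
  obtain ⟨T, hT, -⟩ := Subgroup.exists_isComplement_right (Subgroup.zpowers g) 1
  obtain ⟨U, hU, -⟩ := Subgroup.exists_isComplement_right (Subgroup.zpowers h) 1
  have hcard : Nat.card T = Nat.card U := by
    have h1 := hT.card_mul_card
    have h2 := hU.card_mul_card
    simp only [SetLike.coe_sort_coe, Nat.card_zpowers] at h1 h2
    rw [← h2, hgh] at h1
    exact Nat.eq_of_mul_eq_mul_left (orderOf_pos h) h1
  let e : T ≃ U := (Finite.card_eq.1 hcard).some
  let c := zpowersEquivZPowers hgh
  let f : G ≃ G := hT.equiv.trans ((Equiv.prodCongr c e).trans hU.equiv.symm)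
  refine ⟨f, fun x => ?_⟩
  have hc : ∀ z : Subgroup.zpowers g,
      ((c (⟨g, Subgroup.mem_zpowers g⟩ * z) : Subgroup.zpowers h) : G) = h * c z := by
    rintro ⟨z, hz⟩
    obtain ⟨k, rfl⟩ := mem_powers_iff_mem_zpowers.2 hz
    have e1 : (c ⟨g ^ k, hz⟩ : G) = h ^ k :=
      congrArg Subtype.val (zpowersEquivZPowers_apply hgh k)
    have e2 : (c ⟨g ^ (k + 1), Subgroup.npow_mem_zpowers g (k + 1)⟩ : G) = h ^ (k + 1) :=
      congrArg Subtype.val (zpowersEquivZPowers_apply hgh (k + 1))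
    have e3 : (⟨g, Subgroup.mem_zpowers g⟩ * ⟨g ^ k, hz⟩ : Subgroup.zpowers g) =
        ⟨g ^ (k + 1), Subgroup.npow_mem_zpowers g (k + 1)⟩ := Subtype.ext (pow_succ' g k).symm
    change (c (⟨g, Subgroup.mem_zpowers g⟩ * ⟨g ^ k, hz⟩) : G) = h * c ⟨g ^ k, hz⟩
    rw [e3, e2, e1, pow_succ']
  have hx := hT.equiv_mul_left ⟨g, Subgroup.mem_zpowers g⟩ x
  simp only at hx
  simp only [f, Equiv.trans_apply, hx, Equiv.prodCongr_apply, Prod.map]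
  change (c _ : G) * (e _ : G) = h * ((c _ : G) * (e _ : G))
  rw [hc, mul_assoc]

/-- The conjugating permutation of `g` and `h` can be chosen to fix all right cosets of a
subgroup containing both. -/
theorem exists_perm_mul_mem [Finite G] (H : Subgroup G) {g h : G} (hg : g ∈ H) (hh : h ∈ H)
    (hgh : orderOf g = orderOf h) :
    ∃ f : Equiv.Perm G, (∀ x, f (g * x) = h * f x) ∧ ∀ x, f x * x⁻¹ ∈ H := by
  obtain ⟨φ, hφ⟩ := exists_perm_mul_of_orderOf_eq (g := (⟨g, hg⟩ : H)) (h := ⟨h, hh⟩)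
    (by simpa using hgh)
  let r := QuotientGroup.rightRel H
  let t : G → G := fun x => (Quotient.mk r x).out
  have ht : ∀ x y, t x = t y ↔ y * x⁻¹ ∈ H := by
    intro x y
    rw [← QuotientGroup.rightRel_apply, Quotient.out_inj]
    exact Quotient.eq
  have htx : ∀ x, x * (t x)⁻¹ ∈ H := by
    intro x
    rw [← QuotientGroup.rightRel_apply]
    exact Quotient.mk_out x
  let f : G → G := fun x => (φ ⟨x * (t x)⁻¹, htx x⟩ : G) * t x
  have hfx : ∀ x, f x * x⁻¹ ∈ H := by
    intro x
    have : f x * x⁻¹ = (φ ⟨x * (t x)⁻¹, htx x⟩ : G) * (x * (t x)⁻¹)⁻¹ := by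
      simp [f, mul_assoc]
    rw [this]
    exact H.mul_mem (SetLike.coe_mem _) (H.inv_mem (htx x))
  have hinj : Function.Injective f := by
    intro x y hxy
    have e : t x = t y := by
      have h1 := (ht _ _).2 (hfx x)
      have h2 := (ht _ _).2 (hfx y)
      rw [h1, h2, hxy]
    have h3 : (φ ⟨x * (t x)⁻¹, htx x⟩ : G) = φ ⟨y * (t y)⁻¹, htx y⟩ := by
      simp only [f, e] at hxy
      simpa [e] using hxy
    have h4 := congrArg Subtype.val (φ.injective (Subtype.ext h3))
    simp only [e] at h4
    exact mul_right_cancel h4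
  refine ⟨Equiv.ofBijective f (Finite.injective_iff_bijective.1 hinj), fun x => ?_, hfx⟩
  have e : t (g * x) = t x := ((ht _ _).2 (by simpa using hg)).symm
  have h2 : (⟨g * x * (t (g * x))⁻¹, htx _⟩ : H) = ⟨g, hg⟩ * ⟨x * (t x)⁻¹, htx x⟩ := by
    ext
    simp [e, mul_assoc]
  simp only [Equiv.ofBijective_apply, f]
  rw [h2, hφ, e]
  simp [mul_assoc]

/-- Two vertex classes `p`, `q` carrying the cycles of `g` and of `h`, and joined along `H`. -/
def joinedCycles {m : ℕ} (p q : Fin m) (H : Subgroup G) (g h : G) : Fin m → Fin m → Set G :=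
  fun i j => {s | (i = p ∧ j = p ∧ (s = g ∨ s = g⁻¹)) ∨ (i = q ∧ j = q ∧ (s = h ∨ s = h⁻¹)) ∨
    (i = p ∧ j = q ∧ s ∈ H) ∨ (i = q ∧ j = p ∧ s ∈ H)}

theorem one_notMem_joinedCycles {m : ℕ} {p q : Fin m} (hpq : p ≠ q) (H : Subgroup G) {g h : G}
    (hg : g ≠ 1) (hh : h ≠ 1) (i : Fin m) : (1 : G) ∉ joinedCycles p q H g h i i := by
  have := hg.symm
  have := hh.symm
  simp only [joinedCycles, Set.mem_ofPred_eq, eq_comm (a := (1 : G)), inv_eq_one]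
  grind

theorem inv_mem_joinedCycles {m : ℕ} {p q : Fin m} (H : Subgroup G) {g h : G} (i j : Fin m)
    (s : G) (hs : s ∈ joinedCycles p q H g h i j) : s⁻¹ ∈ joinedCycles p q H g h j i := by
  simp only [joinedCycles, Set.mem_ofPred_eq, inv_eq_iff_eq_inv, inv_inv, inv_mem_iff] at hs ⊢
  tauto

theorem not_isMCIGroup_of_commute [Finite G] {m : ℕ} (hm : 2 ≤ m) {g h : G} (hcomm : Commute g h)
    (hord : orderOf g = orderOf h) (hg : g ≠ 1) (hne : h ≠ g) (hne' : h ≠ g⁻¹) :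
    ¬ IsMCIGroup m G := by
  intro hG
  have hh : h ≠ 1 := by rwa [ne_eq, ← orderOf_eq_one_iff, ← hord, orderOf_eq_one_iff]
  let p : Fin m := ⟨0, by omega⟩
  let q : Fin m := ⟨1, by omega⟩
  have hpq : p ≠ q := by simp [p, q]
  let H : Subgroup G := Subgroup.closure {g, h}
  have hgH : g ∈ H := Subgroup.subset_closure (by simp)
  have hhH : h ∈ H := Subgroup.subset_closure (by simp)
  have hHc : ∀ x ∈ H, ∀ y ∈ H, x * y = y * x := by
    have : IsMulCommutative H := Subgroup.isMulCommutative_closure (by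
      rintro x (rfl | rfl) y (rfl | rfl)
      exacts [rfl, hcomm, hcomm.symm, rfl])
    intro x hx y hy
    exact congrArg Subtype.val (mul_comm' (⟨x, hx⟩ : H) ⟨y, hy⟩)
  obtain ⟨f, hf, hfH⟩ := exists_perm_mul_mem H hgH hhH hord
  have hcyc : ∀ x y, (y * x⁻¹ = g ∨ y * x⁻¹ = g⁻¹) ↔
      (f y * (f x)⁻¹ = h ∨ f y * (f x)⁻¹ = h⁻¹) := by
    intro x y
    have e1 : y * x⁻¹ = g⁻¹ ↔ g * y = x := by
      rw [mul_inv_eq_iff_eq_mul, eq_inv_mul_iff_mul_eq]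
    have e2 : f y * (f x)⁻¹ = h⁻¹ ↔ h * f y = f x := by
      rw [mul_inv_eq_iff_eq_mul, eq_inv_mul_iff_mul_eq]
    rw [e1, e2, mul_inv_eq_iff_eq_mul, mul_inv_eq_iff_eq_mul, ← hf, ← hf, f.injective.eq_iff,
      f.injective.eq_iff]
  have hleft : ∀ x y, f y * x⁻¹ ∈ H ↔ y * x⁻¹ ∈ H := by
    intro x y
    rw [show f y * x⁻¹ = (f y * y⁻¹) * (y * x⁻¹) by group]
    exact H.mul_mem_cancel_left (hfH y)
  have hright : ∀ x y, y * (f x)⁻¹ ∈ H ↔ y * x⁻¹ ∈ H := by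
    intro x y
    rw [← inv_mem_iff, mul_inv_rev, inv_inv, hleft, ← inv_mem_iff, mul_inv_rev, inv_inv]
  -- Only class `q` is moved; as `f` fixes the cosets of `H`, the join survives.
  let φ : Equiv.Perm (Vertex m G) :=
    Equiv.prodShear (Equiv.refl _) fun i => if i = q then f else Equiv.refl G
  obtain ⟨n, hn, hadj⟩ := hG.exists_mem_normalizerR
    (one_notMem_joinedCycles hpq H hg hg) (inv_mem_joinedCycles H)
    (one_notMem_joinedCycles hpq H hg hh) (inv_mem_joinedCycles H) φ
    (by
      rintro ⟨i, x⟩ ⟨j, y⟩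
      rw [cay_adj, cay_adj]
      by_cases hi : i = q <;> by_cases hj : j = q <;>
        simp [joinedCycles, φ, Equiv.prodShear, hi, hj, hpq.symm, hcyc, hleft, hright])
  obtain ⟨s, hs⟩ := exists_apply_mul_of_mem_normalizerR hn g
  have hpp := (hadj (p, 1) (p, 1 * g)).1 ((cay_adj _ _ _).2 (by simp [joinedCycles]))
  have hqq := (hadj (q, 1) (q, 1 * g)).1 ((cay_adj _ _ _).2 (by simp [joinedCycles]))
  have hpq' := (hadj (p, 1) (q, 1)).1 ((cay_adj _ _ _).2 (by simp [joinedCycles]))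
  rw [cay_adj, hs] at hpp hqq
  rw [cay_adj] at hpq'
  have hne1 : (n (p, 1)).1 ≠ (n (q, 1)).1 :=
    fun h => hpq (eq_of_fst_apply_eq_of_mem_normalizerR hn h)
  generalize n (p, 1) = u at *
  generalize n (q, 1) = v at *
  obtain ⟨i, c⟩ := u
  obtain ⟨j, d⟩ := v
  simp only [joinedCycles, Set.mem_ofPred_eq] at hpp hqq hpq' hne1
  have hdc : d * c⁻¹ ∈ H := by grind
  have hcs : c * s * c⁻¹ ∈ H := by
    have := inv_mem hgH
    have := inv_mem hhH
    grind
  -- Since `H` is abelian and contains `d * c⁻¹`, both classes see the same conjugate of `s`. It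
  -- would have to be `g` or `g⁻¹` in one class and `h` or `h⁻¹` in the other.
  have key : d * s * d⁻¹ = c * s * c⁻¹ := by
    have := hHc _ hdc _ hcs
    calc d * s * d⁻¹ = (d * c⁻¹) * (c * s * c⁻¹) * (d * c⁻¹)⁻¹ := by group
      _ = c * s * c⁻¹ := by rw [this]; group
  rw [key] at hqq
  have hne2 : h⁻¹ ≠ g := fun e => hne' (by rw [← e, inv_inv])
  have hne3 : h⁻¹ ≠ g⁻¹ := fun e => hne (inv_injective e)
  grind

end Commuting



/-! ### Reduction to order three -/

section GroupTheory

variable {G : Type*} [Group G] [Finite G]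

theorem not_isMCIGroup_of_odd_orderOf {m : ℕ} (hm : 2 ≤ m) {g : G} (hodd : Odd (orderOf g))
    (h5 : 5 ≤ orderOf g) : ¬ IsMCIGroup m G := by
  have hpow : ∀ k, 0 < k → k < 5 → g ^ k ≠ 1 := fun k hk hk5 h =>
    absurd (Nat.le_of_dvd hk (orderOf_dvd_of_pow_eq_one h)) (by omega)
  refine not_isMCIGroup_of_commute (g := g) (h := g ^ 2) hm ((Commute.refl g).pow_right 2)
    (Nat.Coprime.orderOf_pow ?_).symm ?_ ?_ ?_
  · exact Nat.coprime_two_right.2 hodd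
  · simpa using hpow 1
  · intro h
    have := hpow 1 (by norm_num) (by norm_num)
    rw [pow_two, mul_eq_left] at h
    exact this (by simpa using h)
  · intro h
    refine hpow 3 (by norm_num) (by norm_num) ?_
    rw [pow_succ, h, inv_mul_cancel]

theorem card_eq_three_of_isMCIGroup {m : ℕ} (hm : 2 ≤ m) [Nontrivial G] (hG : IsMCIGroup m G) :
    m = 2 ∧ Nat.card G = 3 := by
  have hsmall : ∀ g : G, g ≠ 1 → m < orderOf g := fun g hg => by
    by_contra! h
    exact not_isMCIGroup_of_orderOf_le g hg h hG
  have hprime : ∀ p : ℕ, p.Prime → p ∣ Nat.card G → p = 3 ∧ m = 2 := by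
    intro p hp hdvd
    have := Fact.mk hp
    obtain ⟨g, hg⟩ := exists_prime_orderOf_dvd_card' p hdvd
    have hg1 : g ≠ 1 := by
      rintro rfl
      exact hp.one_lt.ne (by simpa using hg)
    have hmp := hsmall g hg1
    rw [hg] at hmp
    have hodd : Odd p := hp.odd_of_ne_two (by omega)
    have : p < 5 := by
      by_contra! h5
      exact not_isMCIGroup_of_odd_orderOf hm (hg ▸ hodd) (hg ▸ h5) hG
    obtain ⟨k, rfl⟩ := hodd
    omega
  have hcard1 : Nat.card G ≠ 1 := (Finite.one_lt_card (α := G)).ne'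
  have hm2 : m = 2 := (hprime _ (Nat.minFac_prime hcard1) (Nat.minFac_dvd _)).2
  refine ⟨hm2, ?_⟩
  have : Fact (Nat.Prime 3) := ⟨Nat.prime_three⟩
  have hP : IsPGroup 3 G := IsPGroup.of_card (n := (Nat.card G).primeFactorsList.length)
    (Nat.eq_prime_pow_of_unique_prime_dvd Nat.card_pos.ne' fun hp hd => (hprime _ hp hd).1)
  have := hP.center_nontrivial
  obtain ⟨g, hgZ⟩ : ∃ g : Subgroup.center G, orderOf g = 3 :=
    exists_prime_orderOf_dvd_card' 3 (by
      obtain ⟨k, hk, hk'⟩ := (hP.to_subgroup (Subgroup.center G)).nontrivial_iff_card.1 inferInstance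
      rw [hk']
      exact dvd_pow_self 3 hk.ne')
  have hg : orderOf (g : G) = 3 := by rw [Subgroup.orderOf_coe, hgZ]
  -- An `x` outside `⟨g⟩` also has order 3 and commutes with the central `g`, which is obstructed.
  have htop : ∀ x : G, x ∈ Subgroup.zpowers (g : G) := by
    intro x
    by_contra hx
    have hx1 : x ≠ 1 := fun h => hx (h ▸ one_mem _)
    have hxm := hsmall x hx1
    obtain ⟨k, hk⟩ := (IsPGroup.iff_orderOf.1 hP) x
    have hodd : Odd (orderOf x) := hk ▸ Odd.pow (by decide)
    by_cases h5 : 5 ≤ orderOf x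
    · exact not_isMCIGroup_of_odd_orderOf hm hodd h5 hG
    · have hx3 : orderOf x = 3 := by
        obtain ⟨l, hl⟩ := hodd
        omega
      refine not_isMCIGroup_of_commute hm (g := (g : G)) (h := x) ?_ (by rw [hg, hx3]) ?_ ?_ ?_ hG
      · exact (Subgroup.mem_center_iff.1 g.2 x).symm
      · intro h
        simp [h] at hg
      · rintro rfl
        exact hx (Subgroup.mem_zpowers _)
      · rintro rfl
        exact hx (inv_mem (Subgroup.mem_zpowers _))
  rw [← hg, orderOf_eq_card_of_forall_mem_zpowers htop]

end GroupTheory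

/-! ### The group of order three with two classes -/

section OrderThree

variable {G : Type*} [Group G]

theorem not_isMDCIGroup_two_of_card_eq_three (hcard : Nat.card G = 3) : ¬ IsMDCIGroup 2 G := by
  intro hG
  have : Finite G := Nat.finite_of_card_ne_zero (by omega)
  have : Fact (Nat.Prime 3) := ⟨Nat.prime_three⟩
  have : IsCyclic G := isCyclic_of_prime_card hcard
  have : IsMulCommutative G := IsCyclic.isMulCommutative
  have hcomm : ∀ x y : G, x * y = y * x := fun x y =>
    IsMulCommutative.is_comm.comm x y
  obtain ⟨g, hg⟩ := exists_prime_orderOf_dvd_card' (G := G) 3 (by rw [hcard])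
  have hg1 : g ≠ 1 := by
    rintro rfl
    simp at hg
  have hgi : g ≠ g⁻¹ := by
    intro h
    have : g ^ 2 = 1 := by rw [pow_two, mul_eq_one_iff_eq_inv]; exact h
    have := Nat.le_of_dvd two_pos (orderOf_dvd_of_pow_eq_one this)
    omega
  let S : G → Fin 2 → Fin 2 → Set G :=
    fun h i j => {s | i = j ∧ ((i = 0 ∧ s = g) ∨ (i = 1 ∧ s = h))}
  have hS : ∀ h, h ≠ 1 → ∀ i, (1 : G) ∉ S h i i := by
    intro h hh i
    have := hg1.symm
    have := hh.symm
    simp only [S, Set.mem_ofPred_eq]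
    tauto
  -- Inversion on class 1 reverses its directed cycle, but conjugation is trivial in `G`, so a
  -- normalizer element gives both cycles the same step `s`.
  let φ : Equiv.Perm (Vertex 2 G) :=
    Equiv.prodShear (Equiv.refl _) fun i => if i = 1 then Equiv.inv G else Equiv.refl G
  obtain ⟨n, hn, him⟩ := hG (cay (S g)) ⟨_, hS g hg1, rfl⟩ (cay (S g⁻¹))
    ⟨_, hS _ (inv_ne_one.2 hg1), rfl⟩ ⟨⟨φ, by
      rintro ⟨i, x⟩ ⟨j, y⟩
      rw [cay_adj, cay_adj]
      have : y⁻¹ * x = g⁻¹ ↔ y * x⁻¹ = g := by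
        rw [← inv_inj, mul_inv_rev, inv_inv, inv_inv, hcomm]
      fin_cases i <;> fin_cases j <;> simp [S, φ, Equiv.prodShear, this]⟩⟩
  rw [image_eq_iff] at him
  obtain ⟨s, hs⟩ := exists_apply_mul_of_mem_normalizerR hn g
  have h0 := (him (0, 1) (0, 1 * g)).1 ((cay_adj _ _ _).2 (by simp [S]))
  have h1 := (him (1, 1) (1, 1 * g)).1 ((cay_adj _ _ _).2 (by simp [S]))
  have hne : (n (0, 1)).1 ≠ (n (1, 1)).1 := fun h =>
    absurd (eq_of_fst_apply_eq_of_mem_normalizerR hn h) (by decide)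
  rw [cay_adj, hs] at h0 h1
  have hconj : ∀ c : G, c * s * c⁻¹ = s := fun c => by rw [hcomm c s, mul_inv_cancel_right]
  simp only [S, Set.mem_ofPred_eq, hconj] at h0 h1
  grind

/-- Used to match the arcs between the classes by translating a single class. -/
theorem exists_mul_mem_iff_of_ncard_eq (e : G ≃* Multiplicative (ZMod 3)) {A B : Set G}
    (h : A.ncard = B.ncard) : ∃ c : G, ∀ x, x ∈ A ↔ c * x ∈ B := by
  classical
  have key : ∀ A B : Finset (ZMod 3), A.card = B.card → ∃ c, ∀ x, x ∈ A ↔ c + x ∈ B := by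
    decide
  let f : G ≃ ZMod 3 := e.toEquiv.trans Multiplicative.toAdd
  obtain ⟨c, hc⟩ := key (f '' A).toFinset (f '' B).toFinset (by
    rw [← Set.ncard_eq_toFinset_card', ← Set.ncard_eq_toFinset_card',
      Set.ncard_image_of_injective _ f.injective, Set.ncard_image_of_injective _ f.injective, h])
  refine ⟨f.symm c, fun x => ?_⟩
  have hx := hc (f x)
  have hf : c + f x = f (f.symm c * x) := by simp [f]
  rw [hf] at hx
  simpa using hx

/-- A permutation acting on the index set and by left multiplication on each class. -/
def leftMulPerm {m : ℕ} (π : Equiv.Perm (Fin m)) (c : Fin m → G) : Equiv.Perm (Vertex m G) :=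
  Equiv.prodShear π fun i => Equiv.mulLeft (c i)

theorem leftMulPerm_apply {m : ℕ} (π : Equiv.Perm (Fin m)) (c : Fin m → G) (u : Vertex m G) :
    leftMulPerm π c u = (π u.1, c u.1 * u.2) := rfl

theorem leftMulPerm_mem_normalizerR {m : ℕ} (π : Equiv.Perm (Fin m)) (c : Fin m → G) :
    leftMulPerm π c ∈ normalizerR m G := by
  have hcomm : ∀ g : G, leftMulPerm π c * rightMul m g = rightMul m g * leftMulPerm π c := by
    intro g
    ext u <;> simp [leftMulPerm_apply, rightMul, mul_assoc]
  refine Subgroup.mem_normalizer_iff.2 fun h => ⟨?_, ?_⟩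
  · rintro ⟨g, rfl⟩
    exact ⟨g, by rw [hcomm, mul_inv_cancel_right]⟩
  · rintro ⟨g, hg⟩
    refine ⟨g, ?_⟩
    rw [eq_mul_inv_iff_mul_eq, ← hcomm] at hg
    exact mul_left_cancel hg

theorem ncard_adj_cay_two [Finite G] (S : Fin 2 → Fin 2 → Set G) (u : Vertex 2 G) :
    {v | (cay S).Adj u v}.ncard = (S u.1 0).ncard + (S u.1 1).ncard := by
  have hinj : ∀ j : Fin 2, Function.Injective fun s : G => ((j, s * u.2) : Vertex 2 G) := by
    intro j a b hab
    simpa using hab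
  have : {v | (cay S).Adj u v} = (fun s : G => ((0, s * u.2) : Vertex 2 G)) '' S u.1 0 ∪
      (fun s : G => ((1, s * u.2) : Vertex 2 G)) '' S u.1 1 := by
    ext ⟨j, y⟩
    simp only [Set.mem_ofPred_eq, cay_adj, Set.mem_union, Set.mem_image, Prod.mk.injEq]
    fin_cases j <;> simp [← eq_mul_inv_iff_mul_eq]
  rw [this, Set.ncard_union_eq ?_ (Set.toFinite _) (Set.toFinite _),
    Set.ncard_image_of_injective _ (hinj 0), Set.ncard_image_of_injective _ (hinj 1)]
  rw [Set.disjoint_left]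
  rintro _ ⟨a, -, rfl⟩ ⟨b, -, hb⟩
  simp at hb

theorem eq_empty_or_eq_compl_one (e : G ≃* Multiplicative (ZMod 3)) {A : Set G}
    (h1 : (1 : G) ∉ A) (hinv : ∀ x ∈ A, x⁻¹ ∈ A) : A = ∅ ∨ A = {1}ᶜ := by
  have key : ∀ x y : Multiplicative (ZMod 3), x ≠ 1 → y ≠ 1 → y = x ∨ y = x⁻¹ := by decide
  rcases A.eq_empty_or_nonempty with h | ⟨x, hx⟩
  · exact Or.inl h
  refine Or.inr (Set.ext fun y => ⟨?_, fun hy => ?_⟩)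
  · rintro hy rfl
    exact h1 hy
  · have hx1 : x ≠ 1 := by rintro rfl; exact h1 hx
    rcases key (e x) (e y) (by simpa using hx1) (by simpa using hy) with h | h
    · rwa [e.injective h]
    · rw [← map_inv] at h
      rw [e.injective h]
      exact hinv x hx

/-- Three pairwise adjacent vertices. -/
def HasTriangle {V : Type*} (Γ : Digraph V) : Prop :=
  ∃ u v w, Γ.Adj u v ∧ Γ.Adj v w ∧ Γ.Adj u w

theorem HasTriangle.map {V : Type*} {Γ Δ : Digraph V} (h : HasTriangle Γ) (φ : Γ.Adj ≃r Δ.Adj) :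
    HasTriangle Δ := by
  obtain ⟨u, v, w, h1, h2, h3⟩ := h
  exact ⟨φ u, φ v, φ w, φ.map_rel_iff.2 h1, φ.map_rel_iff.2 h2, φ.map_rel_iff.2 h3⟩

theorem hasTriangle_cay_of_eq_compl_one (e : G ≃* Multiplicative (ZMod 3))
    {S : Fin 2 → Fin 2 → Set G} {i : Fin 2} (h : S i i = {1}ᶜ) : HasTriangle (cay S) := by
  let g : G := e.symm (Multiplicative.ofAdd 1)
  have hg : g ≠ 1 := by
    simp only [g, ne_eq, EmbeddingLike.map_eq_one_iff]
    decide
  have hg2 : g * g ≠ 1 := by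
    simp only [g, ne_eq, ← map_mul, EmbeddingLike.map_eq_one_iff]
    decide
  exact ⟨(i, 1), (i, g), (i, g * g), by simp [cay_adj, h, hg], by simp [cay_adj, h, hg],
    by simpa [cay_adj, h] using hg2⟩

/-- Among three vertices in two classes, two share a class. -/
theorem exists_nonempty_of_hasTriangle {S : Fin 2 → Fin 2 → Set G} (h : HasTriangle (cay S)) :
    ∃ i, (S i i).Nonempty := by
  obtain ⟨u, v, w, h1, h2, h3⟩ := h
  rw [cay_adj] at h1 h2 h3
  have : u.1 = v.1 ∨ v.1 = w.1 ∨ u.1 = w.1 := by omega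
  rcases this with h | h | h
  · exact ⟨v.1, _, h ▸ h1⟩
  · exact ⟨w.1, _, h ▸ h2⟩
  · exact ⟨w.1, _, h ▸ h3⟩

/-- Degrees alone do not separate a 6-cycle from two triangles; `hst` records the presence of
triangles. -/
theorem eq_or_swap_of_degrees {s₀ s₁ a t₀ t₁ b : ℕ} (hs₀ : s₀ = 0 ∨ s₀ = 2)
    (hs₁ : s₁ = 0 ∨ s₁ = 2) (ht₀ : t₀ = 0 ∨ t₀ = 2) (ht₁ : t₁ = 0 ∨ t₁ = 2)
    (hst : s₀ ≠ 0 ∨ s₁ ≠ 0 ↔ t₀ ≠ 0 ∨ t₁ ≠ 0)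
    (h₀ : s₀ + a = t₀ + b ∨ s₀ + a = t₁ + b) (h₁ : s₁ + a = t₀ + b ∨ s₁ + a = t₁ + b)
    (k₀ : s₀ + a = t₀ + b ∨ s₁ + a = t₀ + b) (k₁ : s₀ + a = t₁ + b ∨ s₁ + a = t₁ + b) :
    a = b ∧ ((s₀ = t₀ ∧ s₁ = t₁) ∨ (s₀ = t₁ ∧ s₁ = t₀)) := by
  rcases hs₀ with rfl | rfl <;> rcases hs₁ with rfl | rfl <;> rcases ht₀ with rfl | rfl <;>
    rcases ht₁ with rfl | rfl <;> omega

theorem isMCIGroup_two_of_mulEquiv (e : G ≃* Multiplicative (ZMod 3)) : IsMCIGroup 2 G := by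
  have : Finite G := Finite.of_equiv _ e.symm.toEquiv
  have hcomm : ∀ x y : G, x * y = y * x := fun x y => e.injective (by simp [mul_comm])
  have hcard : Nat.card G = 3 := by rw [Nat.card_congr e.toEquiv]; simp
  have hcompl : ({1}ᶜ : Set G).ncard = 2 := by
    rw [Set.ncard_compl, hcard, Set.ncard_singleton]
  have hinv : ∀ S : Fin 2 → Fin 2 → Set G, IsGraph (cay S) → ∀ i j s, s ∈ S i j → s⁻¹ ∈ S j i := by
    intro S hS i j s hs
    have := hS (i, 1) (j, s) ((cay_adj _ _ _).2 (by simpa using hs))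
    simpa [cay_adj] using this
  rintro _ ⟨⟨S, hS1, rfl⟩, hS⟩ _ ⟨⟨T, hT1, rfl⟩, hT⟩ ⟨φ⟩
  replace hS := hinv S hS
  replace hT := hinv T hT
  have hswap : ∀ S : Fin 2 → Fin 2 → Set G, (∀ i j s, s ∈ S i j → s⁻¹ ∈ S j i) →
      (S 1 0).ncard = (S 0 1).ncard := by
    intro S hS
    have : S 1 0 = (S 0 1)⁻¹ := Set.ext fun x =>
      ⟨fun h => hS 1 0 x h, fun h => by simpa using hS 0 1 _ h⟩
    rw [this, Set.ncard_inv]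
  have hdeg : ∀ u, (S u.1 0).ncard + (S u.1 1).ncard =
      (T (φ u).1 0).ncard + (T (φ u).1 1).ncard := by
    intro u
    rw [← ncard_adj_cay_two, ← ncard_adj_cay_two,
      ← Set.ncard_image_of_injective _ φ.injective]
    congr 1
    ext v
    constructor
    · rintro ⟨w, hw, rfl⟩
      exact φ.map_rel_iff.2 hw
    · intro hv
      exact ⟨φ.symm v, φ.map_rel_iff.1 (by simpa using hv), by simp⟩
  suffices h : ∃ π : Equiv.Perm (Fin 2), (∀ i, S i i = T (π i) (π i)) ∧
      (S 0 1).ncard = (T (π 0) (π 1)).ncard by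
    obtain ⟨π, hd, hoff⟩ := h
    obtain ⟨c, hc⟩ := exists_mul_mem_iff_of_ncard_eq e hoff
    -- Translating class 1 by `c` aligns the cross arcs and, `G` being abelian, leaves the arcs
    -- within that class alone.
    refine ⟨leftMulPerm π ![1, c], leftMulPerm_mem_normalizerR _ _, ?_⟩
    rw [image_eq_iff]
    have hc' : ∀ x, x ∈ S 1 0 ↔ x * c⁻¹ ∈ T (π 1) (π 0) := by
      intro x
      constructor
      · intro hx
        have := hT _ _ _ ((hc _).1 (hS _ _ _ hx))
        simpa using this
      · intro hx
        have := hT _ _ _ hx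
        rw [mul_inv_rev, inv_inv, ← hc] at this
        simpa using hS _ _ _ this
    rintro ⟨i, x⟩ ⟨j, y⟩
    rw [cay_adj, cay_adj, leftMulPerm_apply, leftMulPerm_apply]
    fin_cases i <;> fin_cases j
    · simp [hd 0]
    · simp [hc, mul_assoc]
    · simp [hc', mul_assoc]
    · have : c * y * (x⁻¹ * c⁻¹) = y * x⁻¹ := by
        rw [hcomm c y, hcomm x⁻¹ c⁻¹]; group
      simp [hd 1, this]
  have hSd := fun i => eq_empty_or_eq_compl_one e (hS1 i) (hS i i)
  have hTd := fun i => eq_empty_or_eq_compl_one e (hT1 i) (hT i i)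
  have htri : (∃ i, (S i i).Nonempty) ↔ ∃ i, (T i i).Nonempty := by
    constructor
    · rintro ⟨i, hi⟩
      exact exists_nonempty_of_hasTriangle
        ((hasTriangle_cay_of_eq_compl_one e ((hSd i).resolve_left hi.ne_empty)).map φ)
    · rintro ⟨i, hi⟩
      exact exists_nonempty_of_hasTriangle
        ((hasTriangle_cay_of_eq_compl_one e ((hTd i).resolve_left hi.ne_empty)).map φ.symm)
  have hn : ∀ A : Set G, A = ∅ ∨ A = {1}ᶜ →
      (A.ncard = 0 ∨ A.ncard = 2) ∧ (A.Nonempty ↔ A.ncard ≠ 0) := by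
    rintro A hA
    refine ⟨?_, by rw [Set.nonempty_iff_ne_empty, ne_eq, ne_eq, Set.ncard_eq_zero]⟩
    rcases hA with rfl | rfl
    · exact Or.inl (Set.ncard_empty _)
    · exact Or.inr hcompl
  have hinj : ∀ A B : Set G, A = ∅ ∨ A = {1}ᶜ → B = ∅ ∨ B = {1}ᶜ → A.ncard = B.ncard → A = B := by
    rintro A B (rfl | rfl) (rfl | rfl) h <;> simp_all
  have two : ∀ i : Fin 2, i = 0 ∨ i = 1 := by decide
  have sS := hswap S hS
  have sT := hswap T hT
  obtain ⟨s0, s0'⟩ := hn _ (hSd 0)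
  obtain ⟨s1, s1'⟩ := hn _ (hSd 1)
  obtain ⟨t0, t0'⟩ := hn _ (hTd 0)
  obtain ⟨t1, t1'⟩ := hn _ (hTd 1)
  simp only [Fin.exists_fin_two, s0', s1', t0', t1'] at htri
  have main : (S 0 1).ncard = (T 0 1).ncard ∧
      (((S 0 0).ncard = (T 0 0).ncard ∧ (S 1 1).ncard = (T 1 1).ncard) ∨
        ((S 0 0).ncard = (T 1 1).ncard ∧ (S 1 1).ncard = (T 0 0).ncard)) := by
    have hrow : ∀ i j, (S i 0).ncard + (S i 1).ncard = (T j 0).ncard + (T j 1).ncard →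
        (S i i).ncard + (S 0 1).ncard = (T j j).ncard + (T 0 1).ncard := by
      intro i j h
      rcases two i with rfl | rfl <;> rcases two j with rfl | rfl <;> omega
    have hST : ∀ i, (S i i).ncard + (S 0 1).ncard = (T 0 0).ncard + (T 0 1).ncard ∨
        (S i i).ncard + (S 0 1).ncard = (T 1 1).ncard + (T 0 1).ncard := by
      intro i
      have h := hrow _ _ (hdeg (i, 1))
      rcases two (φ (i, 1)).1 with hj | hj
      · exact Or.inl (by simpa only [hj] using h)
      · exact Or.inr (by simpa only [hj] using h)
    have hTS : ∀ j, (S 0 0).ncard + (S 0 1).ncard = (T j j).ncard + (T 0 1).ncard ∨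
        (S 1 1).ncard + (S 0 1).ncard = (T j j).ncard + (T 0 1).ncard := by
      intro j
      have h := hrow _ _ (hdeg (φ.symm (j, 1)))
      simp only [RelIso.apply_symm_apply] at h
      rcases two (φ.symm (j, 1)).1 with hi | hi
      · exact Or.inl (by simpa only [hi] using h)
      · exact Or.inr (by simpa only [hi] using h)
    exact eq_or_swap_of_degrees s0 s1 t0 t1 htri (hST 0) (hST 1) (hTS 0) (hTS 1)
  obtain ⟨hoff, ⟨h0, h1⟩ | ⟨h0, h1⟩⟩ := main
  · refine ⟨1, fun i => ?_, by simpa using hoff⟩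
    rcases two i with rfl | rfl
    · exact hinj _ _ (hSd 0) (hTd 0) h0
    · exact hinj _ _ (hSd 1) (hTd 1) h1
  · refine ⟨Equiv.swap 0 1, fun i => ?_, by simp [hoff, sT]⟩
    rcases two i with rfl | rfl
    · exact hinj _ _ (hSd 0) (hTd 1) h0
    · exact hinj _ _ (hSd 1) (hTd 0) h1

end OrderThree

end MCayley

theorem mainTheorem2 (m : ℕ) (hm : 2 ≤ m) (G : Type*) [Group G] [Finite G] :
    (MCayley.IsMCIGroup m G ↔
      (m = 2 ∧ (Subsingleton G ∨ Nonempty (G ≃* Multiplicative (ZMod 3)))) ∨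
        (3 ≤ m ∧ Subsingleton G)) ∧
    (MCayley.IsMDCIGroup m G ↔ Subsingleton G) := by
  have hmul : Nat.card G = 3 → Nonempty (G ≃* Multiplicative (ZMod 3)) := by
    intro h
    have : Fact (Nat.Prime 3) := ⟨Nat.prime_three⟩
    exact ⟨mulEquivOfPrimeCardEq (p := 3) h (by simp)⟩
  refine ⟨⟨fun hG => ?_, ?_⟩, fun hG => ?_, fun h => MCayley.isMDCIGroup_of_subsingleton⟩
  · rcases subsingleton_or_nontrivial G with h | h
    · rcases hm.eq_or_lt with rfl | h3
      · exact Or.inl ⟨rfl, Or.inl h⟩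
      · exact Or.inr ⟨h3, h⟩
    · obtain ⟨h2, h3⟩ := MCayley.card_eq_three_of_isMCIGroup hm hG
      exact Or.inl ⟨h2, Or.inr (hmul h3)⟩
  · rintro (⟨rfl, h | ⟨⟨e⟩⟩⟩ | ⟨-, h⟩)
    · exact MCayley.isMDCIGroup_of_subsingleton.isMCIGroup
    · exact MCayley.isMCIGroup_two_of_mulEquiv e
    · exact MCayley.isMDCIGroup_of_subsingleton.isMCIGroup
  · rcases subsingleton_or_nontrivial G with h | h
    · exact h
    · obtain ⟨rfl, h3⟩ := MCayley.card_eq_three_of_isMCIGroup hm hG.isMCIGroup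
      exact absurd hG (MCayley.not_isMDCIGroup_two_of_card_eq_three h3)
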